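/- Let $R$ and $S$ be commutative Noetherian local rings with maximal ideals $\mathfrak m$ and $\mathfrak n$, and let $R \to S$ be a local ring homomorphism (that is, $\mathfrak m S \subseteq \mathfrak n$). Assume that $S$ has finite flat dimension over $R$, $\operatorname{fd}_R S<\infty$: there are an integer $n\ge 0$ and an exact sequence $0\to T_n\to\cdots\to T_0\to S\to 0$ of $R$-modules in which every $T_i$ is flat. For a commutative ring $A$ consider the following conditions. (SAC) For every finitely generated $A$-module $M$: if $\operatorname{Ext}_A^i(M,A)=0$ for all $i>0$ and $\operatorname{Ext}_A^i(M,M)=0$ for all sufficiently large $i$, then $\operatorname{Ext}_A^i(M,M)=0$ for all $i>0$. (ARC) For every finitely generated $A$-module $M$: if $\operatorname{Ext}_A^i(M,M\oplus A)=0$ for all $i>0$, then $M$ is projective. Then: 1. If $S$ satisfies (SAC), then $R$ satisfies (SAC). 2. If $S$ satisfies (ARC), then $R$ satisfies (ARC). -/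

import Mathlib

open CategoryTheory

universe u

/-- `ExtVanishes R M N i` means `Ext^i_R(M, N) = 0`. -/
def ExtVanishes (R : Type u) [CommRing R] (M N : Type u) [AddCommGroup M] [Module R M]
    [AddCommGroup N] [Module R N] (i : ℕ) : Prop :=
  Subsingleton (Abelian.Ext.{u} (ModuleCat.of R M) (ModuleCat.of R N) i)

/-- The symmetric Auslander condition (SAC): every finitely generated `R`-module `M` with
`Ext^i_R(M, R) = 0` for all `i > 0` and `Ext^i_R(M, M) = 0` for all large enough `i` has
`Ext^i_R(M, M) = 0` for all `i > 0`. -/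
def SymmetricAuslanderCondition (R : Type u) [CommRing R] : Prop :=
  ∀ (M : Type u) [AddCommGroup M] [Module R M] [Module.Finite R M],
    (∀ i : ℕ, 0 < i → ExtVanishes R M R i) →
    (∃ n : ℕ, ∀ i : ℕ, n < i → ExtVanishes R M M i) →
    ∀ i : ℕ, 0 < i → ExtVanishes R M M i

/-- The Auslander-Reiten condition (ARC): every finitely generated `R`-module `M` with
`Ext^i_R(M, M ⊕ R) = 0` for all `i > 0` is projective. -/
def AuslanderReitenCondition (R : Type u) [CommRing R] : Prop :=
  ∀ (M : Type u) [AddCommGroup M] [Module R M] [Module.Finite R M],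
    (∀ i : ℕ, 0 < i → ExtVanishes R M (M × R) i) → Module.Projective R M

/-- `M` has finite flat dimension over `R`: there is an exact sequence
`0 → T n → ⋯ → T 0 → M → 0` of `R`-modules with all `T i` flat. The sequence is extended by
zero modules in degrees above `n`, so that exactness at `T n` says that `T n → T (n - 1)`
(or `T 0 → M`, if `n = 0`) is injective. -/
def HasFiniteFlatDimension (R : Type u) [CommRing R] (M : Type u) [AddCommGroup M]
    [Module R M] : Prop :=
  ∃ (n : ℕ) (T : ℕ → ModuleCat.{u} R) (d : ∀ i : ℕ, T (i + 1) →ₗ[R] T i) (ε : T 0 →ₗ[R] M),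
    (∀ i : ℕ, Module.Flat R (T i)) ∧ (∀ i : ℕ, n < i → Subsingleton (T i)) ∧
    Function.Surjective ε ∧ Function.Exact (d 0) ε ∧
    ∀ i : ℕ, Function.Exact (d (i + 1)) (d i)

open TensorProduct

/-! ### Vanishing of Ext by dimension shifting -/

section ExtVanishing

variable {R : Type u} [CommRing R]
variable {K F M N : Type u} [AddCommGroup K] [Module R K] [AddCommGroup F] [Module R F]
  [AddCommGroup M] [Module R M] [AddCommGroup N] [Module R N]

/-! Write `ΩM` for the kernel of a finite free cover of `M`. If `Ext^i(M, R) = 0` for `i > 0`, then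
`ΩM` inherits this, and `Ext^i(ΩM, ΩM)` vanishes exactly when `Ext^i(M, M)` does
(`extVanishes_ker_ker_iff`). Each syzygy lowers the Tor bound against `S` by one, so after finitely
many steps `M` is Tor-independent of `S`.

For Tor-independent `M` and `N`, the top nonvanishing `Ext^i(M, N)` survives base change
(`extVanishes_baseChange_iff`). Shifting reduces this to `Ext^1`, the cokernel of `N^b → Hom(ΩM,
N)`; there Hom commutes with base change and Nakayama applies.

For (SAC), this kills `Ext^i(M, M)` from the top down. For (ARC), `S ⊗ M` is projective, so
`Ext^1(M, ΩM) = 0` by descent and `M` splits off a free module. -/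

theorem shortExact_of_linearMap {i : K →ₗ[R] F} {p : F →ₗ[R] M} (hi : Function.Injective i)
    (hip : Function.Exact i p) (hp : Function.Surjective p) :
    (ShortComplex.mk (ModuleCat.ofHom i) (ModuleCat.ofHom p)
      (by ext x; exact hip.apply_apply_eq_zero x)).ShortExact where
  exact := (ShortComplex.ShortExact.moduleCat_exact_iff_function_exact _).mpr hip
  mono_f := (ModuleCat.mono_iff_injective _).mpr hi
  epi_g := (ModuleCat.epi_iff_surjective _).mpr hp

/-- With the dimension shift below, this turns questions about Ext into extending maps along a
syzygy. -/
theorem extVanishes_one_iff [Module.Projective R F] {i : K →ₗ[R] F} {p : F →ₗ[R] M}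
    (hi : Function.Injective i) (hip : Function.Exact i p) (hp : Function.Surjective p) :
    ExtVanishes R M N 1 ↔ Function.Surjective (i.lcomp R N) := by
  have hS := shortExact_of_linearMap hi hip hp
  constructor
  · intro h f
    have h : Subsingleton (Abelian.Ext (ModuleCat.of R M) (ModuleCat.of R N) 1) := h
    obtain ⟨y, hy⟩ := Abelian.Ext.contravariant_sequence_exact₁ hS (ModuleCat.of R N)
      (Abelian.Ext.mk₀ (ModuleCat.ofHom f)) rfl (h.elim _ _)
    obtain ⟨g, rfl⟩ := (Abelian.Ext.mk₀_bijective _ _).2 y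
    rw [Abelian.Ext.mk₀_comp_mk₀, (Abelian.Ext.mk₀_bijective _ _).1.eq_iff] at hy
    exact ⟨g.hom, congrArg ModuleCat.Hom.hom hy⟩
  · intro h
    refine subsingleton_of_forall_eq 0 fun x ↦ ?_
    obtain ⟨y, rfl⟩ := Abelian.Ext.contravariant_sequence_exact₃ hS (ModuleCat.of R N) x
      (Abelian.Ext.eq_zero_of_projective _) (n₀ := 0) rfl
    obtain ⟨f, rfl⟩ := (Abelian.Ext.mk₀_bijective _ _).2 y
    obtain ⟨g, hg⟩ := h f.hom
    have : f = ModuleCat.ofHom i ≫ ModuleCat.ofHom g := by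
      ext x
      exact (LinearMap.congr_fun hg x).symm
    rw [this, ← Abelian.Ext.mk₀_comp_mk₀]
    exact hS.extClass_comp_assoc _

theorem extVanishes_add_two_iff [Module.Projective R F] {i : K →ₗ[R] F} {p : F →ₗ[R] M}
    (hi : Function.Injective i) (hip : Function.Exact i p) (hp : Function.Surjective p) (n : ℕ) :
    ExtVanishes R M N (n + 2) ↔ ExtVanishes R K N (n + 1) := by
  have hS := shortExact_of_linearMap hi hip hp
  constructor
  · intro h
    have h : Subsingleton (Abelian.Ext (ModuleCat.of R M) (ModuleCat.of R N) (n + 2)) := h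
    refine subsingleton_of_forall_eq 0 fun x ↦ ?_
    obtain ⟨y, rfl⟩ := Abelian.Ext.contravariant_sequence_exact₁ hS (ModuleCat.of R N) x
      (n₁ := n + 2) (by lia) (h.elim _ _)
    rw [Abelian.Ext.eq_zero_of_projective y, Abelian.Ext.comp_zero]
  · intro h
    have h : Subsingleton (Abelian.Ext (ModuleCat.of R K) (ModuleCat.of R N) (n + 1)) := h
    refine subsingleton_of_forall_eq 0 fun x ↦ ?_
    obtain ⟨y, rfl⟩ := Abelian.Ext.contravariant_sequence_exact₃ hS (ModuleCat.of R N) x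
      (Abelian.Ext.eq_zero_of_projective _) (n₀ := n + 1) (by lia)
    rw [Subsingleton.elim y 0, Abelian.Ext.comp_zero]

theorem extVanishes_succ_iff_of_extVanishes_middle {L : Type u} [AddCommGroup L] [Module R L]
    {i : K →ₗ[R] F} {p : F →ₗ[R] M} (hi : Function.Injective i) (hip : Function.Exact i p)
    (hp : Function.Surjective p) (n : ℕ) (h₀ : ExtVanishes R L F n)
    (h₁ : ExtVanishes R L F (n + 1)) :
    ExtVanishes R L K (n + 1) ↔ ExtVanishes R L M n := by
  have hS := shortExact_of_linearMap hi hip hp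
  have h₀ : Subsingleton (Abelian.Ext (ModuleCat.of R L) (ModuleCat.of R F) n) := h₀
  have h₁ : Subsingleton (Abelian.Ext (ModuleCat.of R L) (ModuleCat.of R F) (n + 1)) := h₁
  constructor
  · intro h
    have h : Subsingleton (Abelian.Ext (ModuleCat.of R L) (ModuleCat.of R K) (n + 1)) := h
    refine subsingleton_of_forall_eq 0 fun x ↦ ?_
    obtain ⟨y, rfl⟩ := Abelian.Ext.covariant_sequence_exact₃ (ModuleCat.of R L) hS x
      (n₁ := n + 1) rfl (h.elim _ _)
    rw [Subsingleton.elim y 0, Abelian.Ext.zero_comp]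
  · intro h
    have h : Subsingleton (Abelian.Ext (ModuleCat.of R L) (ModuleCat.of R M) n) := h
    refine subsingleton_of_forall_eq 0 fun x ↦ ?_
    obtain ⟨y, rfl⟩ := Abelian.Ext.covariant_sequence_exact₁ (ModuleCat.of R L) hS x
      (h₁.elim _ _) (n₀ := n) rfl
    rw [Subsingleton.elim y 0, Abelian.Ext.zero_comp]

theorem extVanishes_one_iff_ker [Module.Projective R F] {p : F →ₗ[R] M}
    (hp : Function.Surjective p) :
    ExtVanishes R M N 1 ↔ Function.Surjective ((LinearMap.ker p).subtype.lcomp R N) :=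
  extVanishes_one_iff (LinearMap.ker p).injective_subtype (LinearMap.exact_subtype_ker_map p) hp

theorem extVanishes_add_two_iff_ker [Module.Projective R F] {p : F →ₗ[R] M}
    (hp : Function.Surjective p) (n : ℕ) :
    ExtVanishes R M N (n + 2) ↔ ExtVanishes R (LinearMap.ker p) N (n + 1) :=
  extVanishes_add_two_iff (LinearMap.ker p).injective_subtype (LinearMap.exact_subtype_ker_map p)
    hp n

variable (R M) in
theorem exists_free_surjective : ∃ p : (M →₀ R) →ₗ[R] M, Function.Surjective p :=
  ⟨Finsupp.linearCombination R id, Finsupp.linearCombination_id_surjective R M⟩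

/-- Vanishing of `Ext(M, N)` in positive degrees passes to retracts of `N`. -/
theorem ExtVanishes.of_retract {N' : Type u} [AddCommGroup N'] [Module R N'] {n : ℕ}
    (h : ExtVanishes R M N (n + 1)) (a : N' →ₗ[R] N) (b : N →ₗ[R] N') (hba : b ∘ₗ a = .id) :
    ExtVanishes R M N' (n + 1) := by
  induction n generalizing M with
  | zero =>
    obtain ⟨p, hp⟩ := exists_free_surjective R M
    rw [extVanishes_one_iff_ker hp] at h ⊢
    intro f
    obtain ⟨g, hg⟩ := h (a ∘ₗ f)
    refine ⟨b ∘ₗ g, ?_⟩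
    ext x
    exact (congrArg b (LinearMap.congr_fun hg x)).trans (LinearMap.congr_fun hba (f x))
  | succ n ih =>
    obtain ⟨p, hp⟩ := exists_free_surjective R M
    rw [extVanishes_add_two_iff_ker hp] at h ⊢
    exact ih h

theorem ExtVanishes.pi {ι : Type} {N : ι → Type u} [∀ j, AddCommGroup (N j)]
    [∀ j, Module R (N j)] {n : ℕ} (h : ∀ j, ExtVanishes R M (N j) (n + 1)) :
    ExtVanishes R M (∀ j, N j) (n + 1) := by
  induction n generalizing M with
  | zero =>
    obtain ⟨p, hp⟩ := exists_free_surjective R M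
    simp only [zero_add, extVanishes_one_iff_ker hp] at h ⊢
    intro f
    choose g hg using fun j ↦ h j (LinearMap.proj j ∘ₗ f)
    refine ⟨LinearMap.pi g, ?_⟩
    ext x j
    exact LinearMap.congr_fun (hg j) x
  | succ n ih =>
    obtain ⟨p, hp⟩ := exists_free_surjective R M
    simp only [extVanishes_add_two_iff_ker hp] at h ⊢
    exact ih h

theorem ExtVanishes.prod {N' : Type u} [AddCommGroup N'] [Module R N'] {n : ℕ}
    (h : ExtVanishes R M N (n + 1)) (h' : ExtVanishes R M N' (n + 1)) :
    ExtVanishes R M (N × N') (n + 1) := by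
  induction n generalizing M with
  | zero =>
    obtain ⟨p, hp⟩ := exists_free_surjective R M
    rw [zero_add, extVanishes_one_iff_ker hp] at h h' ⊢
    intro f
    obtain ⟨g, hg⟩ := h (LinearMap.fst R N N' ∘ₗ f)
    obtain ⟨g', hg'⟩ := h' (LinearMap.snd R N N' ∘ₗ f)
    refine ⟨g.prod g', ?_⟩
    ext x
    · exact LinearMap.congr_fun hg x
    · exact LinearMap.congr_fun hg' x
  | succ n ih =>
    obtain ⟨p, hp⟩ := exists_free_surjective R M
    rw [extVanishes_add_two_iff_ker hp] at h h' ⊢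
    exact ih h h'

theorem extVanishes_of_projective [Module.Projective R M] (n : ℕ) :
    ExtVanishes R M N (n + 1) :=
  Abelian.Ext.subsingleton_of_projective _ _ _

theorem projective_of_extVanishes_ker [Module.Projective R F] {p : F →ₗ[R] M}
    (hp : Function.Surjective p) (h : ExtVanishes R M (LinearMap.ker p) 1) :
    Module.Projective R M := by
  rw [extVanishes_one_iff_ker hp] at h
  obtain ⟨r, hr⟩ := h .id
  have := (Function.Exact.split_tfae (LinearMap.exact_subtype_ker_map p)
    (LinearMap.ker p).injective_subtype hp).out 0 1
  obtain ⟨s, hs⟩ := this.mpr ⟨r, hr⟩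
  exact Module.Projective.of_split s p hs

end ExtVanishing

/-! ### Tor-vanishing through a fixed finite flat resolution -/

section TorVanishing

/-- A finite flat resolution of the `R`-module `Y`, extended by zero modules in degrees above
`length`. -/
structure FiniteFlatResolution (R : Type u) [CommRing R] (Y : Type u) [AddCommGroup Y]
    [Module R Y] where
  length : ℕ
  T : ℕ → ModuleCat.{u} R
  d : ∀ i, T (i + 1) →ₗ[R] T i
  ε : T 0 →ₗ[R] Y
  flat : ∀ i, Module.Flat R (T i)
  subsingleton : ∀ i, length < i → Subsingleton (T i)
  surjective : Function.Surjective ε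
  exact_zero : Function.Exact (d 0) ε
  exact_succ : ∀ i, Function.Exact (d (i + 1)) (d i)

theorem HasFiniteFlatDimension.nonempty_finiteFlatResolution {R : Type u} [CommRing R]
    {Y : Type u} [AddCommGroup Y] [Module R Y] (h : HasFiniteFlatDimension R Y) :
    Nonempty (FiniteFlatResolution R Y) := by
  obtain ⟨n, T, d, ε, h₁, h₂, h₃, h₄, h₅⟩ := h
  exact ⟨⟨n, T, d, ε, h₁, h₂, h₃, h₄, h₅⟩⟩

variable {R : Type u} [CommRing R] {Y : Type u} [AddCommGroup Y] [Module R Y]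

attribute [instance] FiniteFlatResolution.flat

/-- If `P` is a finite flat resolution of `Y`, this says that
`Tor_i(Y, X) = 0` for all `i > k`. -/
def TorVanishesAbove (P : FiniteFlatResolution R Y) (k : ℕ) (X : Type u) [AddCommGroup X] [Module R X] : Prop :=
  ∀ i, k ≤ i → Function.Injective ((LinearMap.range (P.d i)).subtype.rTensor X)

variable {P : FiniteFlatResolution R Y} {A B X : Type u} [AddCommGroup A] [Module R A] [AddCommGroup B] [Module R B]
  [AddCommGroup X] [Module R X]

theorem TorVanishesAbove.mono {k l : ℕ} (h : TorVanishesAbove P k X) (hkl : k ≤ l) :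
    TorVanishesAbove P l X :=
  fun i hi ↦ h i (hkl.trans hi)

theorem torVanishesAbove_length : TorVanishesAbove P P.length X := by
  intro i hi
  have := P.subsingleton (i + 1) (by lia)
  have : Subsingleton (LinearMap.range (P.d i)) :=
    (LinearMap.surjective_rangeRestrict (P.d i)).subsingleton
  exact Function.injective_of_subsingleton _

theorem torVanishesAbove_of_flat [Module.Flat R X] (k : ℕ) : TorVanishesAbove P k X :=
  fun _ _ ↦ Module.Flat.rTensor_preserves_injective_linearMap _ (Submodule.injective_subtype _)

/-- The `Tor`-sequence of `0 → A → B → X → 0` in degrees `k + 1` and `k + 2`. -/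
theorem TorVanishesAbove.of_shortExact {k : ℕ} {i : A →ₗ[R] B} {p : B →ₗ[R] X}
    (hi : Function.Injective i) (hip : Function.Exact i p) (hp : Function.Surjective p)
    (hB : TorVanishesAbove P k B) (hX : TorVanishesAbove P (k + 1) X) :
    TorVanishesAbove P k A := by
  intro j hj
  -- The kernel of this map is governed by `Tor_1(range (d j), X) = Tor_{j+2}(Y, X)`, whence the
  -- bound `k + 1` on `X`.
  have hA : Function.Injective (i.lTensor (LinearMap.range (P.d j))) := by
    refine lTensor_injective_of_exact_of_exact_of_rTensor_injective
      (f₁ := (LinearMap.range (P.d (j + 1))).subtype) (f₂ := (P.d j).rangeRestrict) ?_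
      (LinearMap.surjective_rangeRestrict _) hip hp (hX (j + 1) (by lia))
      (Module.Flat.lTensor_preserves_injective_linearMap _ hi)
    intro x
    have := P.exact_succ j x
    simp only [LinearMap.mem_range, Set.mem_range, Subtype.exists, Submodule.subtype_apply,
      Subtype.ext_iff, LinearMap.codRestrict_apply, LinearMap.rangeRestrict] at this ⊢
    simpa using this
  have h := (hB j hj).comp hA
  rw [← LinearMap.coe_comp, LinearMap.rTensor_comp_lTensor, ← LinearMap.lTensor_comp_rTensor,
    LinearMap.coe_comp] at h
  exact h.of_comp

theorem TorVanishesAbove.lTensor_injective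
    {i : A →ₗ[R] B} {p : B →ₗ[R] X}
    (hi : Function.Injective i) (hip : Function.Exact i p) (hp : Function.Surjective p)
    (hX : TorVanishesAbove P 0 X) : Function.Injective (i.lTensor Y) := by
  refine lTensor_injective_of_exact_of_exact_of_rTensor_injective
      (f₁ := (LinearMap.range (P.d 0)).subtype) (f₂ := P.ε) ?_
      P.surjective hip hp (hX 0 le_rfl) (Module.Flat.lTensor_preserves_injective_linearMap _ hi)
  intro x
  simpa using P.exact_zero x

theorem TorVanishesAbove.of_linearEquiv {k : ℕ} (e : A ≃ₗ[R] B) (h : TorVanishesAbove P k A) :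
    TorVanishesAbove P k B := by
  intro j hj
  have h := ((LinearEquiv.lTensor (P.T j) e).injective.comp (h j hj)).comp
    (LinearEquiv.lTensor (LinearMap.range (P.d j)) e.symm).injective
  convert h using 1
  rw [← LinearEquiv.coe_toLinearMap, ← LinearEquiv.coe_toLinearMap, ← LinearMap.coe_comp,
    ← LinearMap.coe_comp]
  congr 1
  ext
  simp

theorem TorVanishesAbove.pi {ι : Type} [Finite ι] {k : ℕ} (h : TorVanishesAbove P k X) :
    TorVanishesAbove P k (ι → X) := by
  classical
  have := Fintype.ofFinite ι
  intro j hj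
  have hinj : Function.Injective fun (x : ι → (LinearMap.range (P.d j)) ⊗[R] X) (a : ι) ↦
      (LinearMap.range (P.d j)).subtype.rTensor X (x a) :=
    Function.Injective.piMap fun _ ↦ h j hj
  have h := (TensorProduct.piRight R R (P.T j) fun _ : ι ↦ X).symm.injective.comp
    (hinj.comp (TensorProduct.piRight R R (LinearMap.range (P.d j)) fun _ : ι ↦ X).injective)
  convert h using 1
  funext x
  simp only [Function.comp_apply]
  rw [LinearEquiv.eq_symm_apply]
  induction x with
  | zero => simp; rfl
  | add x y hx hy => simp only [map_add, hx, hy]; ext; simp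
  | tmul x y => ext; simp

end TorVanishing

/-! ### The Hom comparison map, and Nakayama along a local homomorphism -/

section BaseChange

variable {R : Type u} [CommRing R] (S : Type u) [CommRing S] [Algebra R S]
variable {A B N : Type u} [AddCommGroup A] [Module R A] [AddCommGroup B] [Module R B]
  [AddCommGroup N] [Module R N]

theorem tensorProduct_lTensor_lcomp (g : A →ₗ[R] B) (x : S ⊗[R] (B →ₗ[R] N)) :
    LinearMap.tensorProduct R S A N ((g.lcomp R N).lTensor S x) =
      LinearMap.tensorProduct R S B N x ∘ₗ g.baseChange S := by
  induction x with
  | zero => simp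
  | add x y hx hy => simp only [map_add, hx, hy, LinearMap.add_comp]
  | tmul s f => ext a; rfl

variable (R N) in
theorem tensorProduct_pi_bijective (ι : Type) [Finite ι] :
    Function.Bijective (LinearMap.tensorProduct R S (ι → R) N) := by
  convert (Module.isBaseChange_map_of_finite_free N S ι).equiv.bijective using 1
  funext x
  induction x with
  | zero => simp
  | add x y hx hy => simp only [map_add, hx, hy]
  | tmul s f => rw [IsBaseChange.equiv_tmul]; rfl

variable [IsLocalRing R] [IsLocalRing S] [IsLocalHom (algebraMap R S)]

theorem subsingleton_of_subsingleton_tensorProduct_of_isLocalHom [Module.Finite R A]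
    [Subsingleton (S ⊗[R] A)] : Subsingleton A := by
  rw [← IsLocalRing.subsingleton_tensorProduct (R := R)]
  refine subsingleton_of_forall_eq 0 fun x ↦ ?_
  rw [← Module.forall_dual_apply_eq_zero_iff (IsLocalRing.ResidueField R)]
  intro f
  -- Composed with the embedding of residue fields, `f` extends to an `S`-linear map on `S ⊗ A = 0`.
  have hf (a : A) : f (1 ⊗ₜ a) = 0 := by
    let φ : IsLocalRing.ResidueField R →ₗ[R] IsLocalRing.ResidueField S :=
      { toFun := IsLocalRing.ResidueField.map (algebraMap R S)
        map_add' := map_add _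
        map_smul' := fun r x ↦ by
          rw [Algebra.smul_def, Algebra.smul_def, map_mul]
          rfl }
    let g : A →ₗ[R] IsLocalRing.ResidueField S :=
      φ ∘ₗ f.restrictScalars R ∘ₗ TensorProduct.mk R (IsLocalRing.ResidueField R) A 1
    have : g.liftBaseChange S (1 ⊗ₜ a) = 0 := by
      rw [Subsingleton.elim ((1 : S) ⊗ₜ[R] a) 0, map_zero]
    rw [LinearMap.liftBaseChange_tmul, one_smul] at this
    exact (map_eq_zero (IsLocalRing.ResidueField.map (algebraMap R S))).mp this
  induction x with
  | zero => simp
  | add x y hx hy => rw [map_add, hx, hy, add_zero]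
  | tmul c a => rw [← mul_one c, ← smul_eq_mul, ← smul_tmul', map_smul, hf, smul_zero]

theorem surjective_of_lTensor_surjective_of_isLocalHom [Module.Finite R B] (g : A →ₗ[R] B)
    (h : Function.Surjective (g.lTensor S)) : Function.Surjective g := by
  rw [← LinearMap.range_eq_top, ← Submodule.Quotient.subsingleton_iff]
  have hq := (LinearMap.range g).mkQ_surjective
  have : Subsingleton (S ⊗[R] (B ⧸ LinearMap.range g)) := by
    refine subsingleton_of_forall_eq 0 fun x ↦ ?_
    obtain ⟨y, rfl⟩ := LinearMap.lTensor_surjective S hq x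
    obtain ⟨z, rfl⟩ := h y
    rw [← LinearMap.comp_apply, ← LinearMap.lTensor_comp, LinearMap.range_mkQ_comp]
    simp
  exact subsingleton_of_subsingleton_tensorProduct_of_isLocalHom (R := R) S

end BaseChange

/-! ### Tor-independence of Hom modules -/

section Hom

variable {R : Type u} [CommRing R] {Y : Type u} [AddCommGroup Y] [Module R Y]
  {P : FiniteFlatResolution R Y} {K N : Type u} [AddCommGroup K] [Module R K]
  [AddCommGroup N] [Module R N]

theorem TorVanishesAbove.pi_hom {ι : Type} [Finite ι] {k : ℕ} (h : TorVanishesAbove P k N) :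
    TorVanishesAbove P k ((ι → R) →ₗ[R] N) := by
  classical
  have := Fintype.ofFinite ι
  exact h.pi.of_linearEquiv (LinearEquiv.piRing R N ι R).symm

theorem lcomp_ker_exact {F : Type u} [AddCommGroup F] [Module R F] {p : F →ₗ[R] K}
    (hp : Function.Surjective p) :
    Function.Exact (p.lcomp R N) ((LinearMap.ker p).subtype.lcomp R N) :=
  LinearMap.exact_lcomp_of_exact_of_surjective _ (LinearMap.exact_subtype_ker_map p) hp

variable [IsNoetherianRing R] [Module.Finite R K]

/-- If `Tor_i(Y, N) = 0` and `Ext^i(K, N) = 0` for all `i > 0`, then `Tor_i(Y, Hom(K, N)) = 0`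
for all `i > 0`. -/
theorem TorVanishesAbove.hom (hN : TorVanishesAbove P 0 N)
    (hK : ∀ i, ExtVanishes R K N (i + 1)) : TorVanishesAbove P 0 (K →ₗ[R] N) := by
  -- Descending induction on `k` from the length of `P`: the bound `k` for `K` follows from `k + 1`
  -- for `ΩK`, by `0 → Hom(K, N) → N^b → Hom(ΩK, N) → 0`.
  suffices ∀ m k, k + m = P.length → TorVanishesAbove P k (K →ₗ[R] N) from
    this P.length 0 (zero_add _)
  intro m
  induction m generalizing K with
  | zero => rintro k rfl; exact torVanishesAbove_length
  | succ m ih =>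
    intro k hk
    obtain ⟨b, p, hp⟩ := Module.Finite.exists_fin' R K
    refine (hN.mono k.zero_le).pi_hom.of_shortExact (p.lcomp_injective_of_surjective hp)
      (lcomp_ker_exact hp) ((extVanishes_one_iff_ker hp).mp (hK 0))
      (ih (fun i ↦ (extVanishes_add_two_iff_ker hp i).mp (hK (i + 1))) (k + 1) (by lia))

end Hom

/-! ### Hom and `Ext^1` under base change -/

section HomBaseChange

variable {R : Type u} [CommRing R] [IsNoetherianRing R] {S : Type u} [CommRing S] [Algebra R S]
  {P : FiniteFlatResolution R S} {K M N : Type u} [AddCommGroup K] [Module R K]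
  [Module.Finite R K] [AddCommGroup M] [Module R M] [Module.Finite R M]
  [AddCommGroup N] [Module R N]

/-- Tor-independence of `Hom(ΩK, N)` keeps `Hom(K, N) → N^b` injective after base change, and the
comparison map is bijective for free modules. -/
theorem tensorProduct_injective_of_extVanishes (hN : TorVanishesAbove P 0 N)
    (hK : ∀ i, ExtVanishes R K N (i + 1)) :
    Function.Injective (LinearMap.tensorProduct R S K N) := by
  obtain ⟨b, p, hp⟩ := Module.Finite.exists_fin' R K
  have h : Function.Injective ((p.lcomp R N).lTensor S) :=
    (hN.hom fun i ↦ (extVanishes_add_two_iff_ker hp i).mp (hK (i + 1))).lTensor_injective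
      (p.lcomp_injective_of_surjective hp) (lcomp_ker_exact hp)
      ((extVanishes_one_iff_ker hp).mp (hK 0))
  intro x y hxy
  apply h
  apply (tensorProduct_pi_bijective R S N (Fin b)).1
  rw [tensorProduct_lTensor_lcomp, tensorProduct_lTensor_lcomp, hxy]

/-- If `Tor_i(S, N) = 0` and `Ext^i(K, N) = 0` for all `i > 0`, then `Hom(K, N)` commutes with
base change to `S`. -/
theorem tensorProduct_bijective_of_extVanishes (hN : TorVanishesAbove P 0 N)
    (hK : ∀ i, ExtVanishes R K N (i + 1)) :
    Function.Bijective (LinearMap.tensorProduct R S K N) := by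
  refine ⟨tensorProduct_injective_of_extVanishes hN hK, fun φ ↦ ?_⟩
  obtain ⟨b, p, hp⟩ := Module.Finite.exists_fin' R K
  obtain ⟨c, hc⟩ := (tensorProduct_pi_bijective R S N (Fin b)).2 (φ ∘ₗ p.baseChange S)
  -- Injectivity of the comparison map for `ΩK` is what lets `c` come from `S ⊗ Hom(K, N)`.
  have hc' : ((LinearMap.ker p).subtype.lcomp R N).lTensor S c = 0 := by
    apply tensorProduct_injective_of_extVanishes hN
      fun i ↦ (extVanishes_add_two_iff_ker hp i).mp (hK (i + 1))
    rw [tensorProduct_lTensor_lcomp, hc, map_zero, LinearMap.comp_assoc,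
      ← LinearMap.baseChange_comp, (LinearMap.exact_subtype_ker_map p).linearMap_comp_eq_zero,
      LinearMap.baseChange_zero, LinearMap.comp_zero]
  obtain ⟨x, rfl⟩ := (lTensor_exact S (lcomp_ker_exact hp)
    ((extVanishes_one_iff_ker hp).mp (hK 0)) c).mp hc'
  refine ⟨x, ?_⟩
  rw [tensorProduct_lTensor_lcomp] at hc
  exact LinearMap.cancel_right (g := p.baseChange S) (LinearMap.lTensor_surjective S hp) |>.mp hc

variable [IsLocalRing R] [IsLocalRing S] [IsLocalHom (algebraMap R S)] [Module.Finite R N]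

/-- Vanishing from degree 2 on makes `Hom(ΩM, N)` commute with base change. Surjectivity of `N^b →
Hom(ΩM, N)` then ascends by right exactness and descends by Nakayama. -/
theorem extVanishes_one_baseChange_iff (hM : TorVanishesAbove P 0 M)
    (hN : TorVanishesAbove P 0 N) (h : ∀ i, ExtVanishes R M N (i + 2)) :
    ExtVanishes S (S ⊗[R] M) (S ⊗[R] N) 1 ↔ ExtVanishes R M N 1 := by
  obtain ⟨b, p, hp⟩ := Module.Finite.exists_fin' R M
  have hip := LinearMap.exact_subtype_ker_map p
  have hiS : Function.Injective ((LinearMap.ker p).subtype.baseChange S) :=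
    hM.lTensor_injective (LinearMap.ker p).injective_subtype hip hp
  have hθ := tensorProduct_bijective_of_extVanishes hN
    fun i ↦ (extVanishes_add_two_iff_ker hp i).mp (h i)
  have hθ' := tensorProduct_pi_bijective R S N (Fin b)
  rw [extVanishes_one_iff_ker hp, extVanishes_one_iff hiS (p := p.baseChange S)
    (lTensor_exact S hip hp) (LinearMap.lTensor_surjective S hp)]
  have hcomm : ((LinearMap.ker p).subtype.baseChange S).lcomp S (S ⊗[R] N) ∘
      LinearMap.tensorProduct R S (Fin b → R) N = LinearMap.tensorProduct R S (LinearMap.ker p) N ∘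
        ((LinearMap.ker p).subtype.lcomp R N).lTensor S :=
    funext fun x ↦ (tensorProduct_lTensor_lcomp S _ x).symm
  constructor
  · intro hs
    have := hs.comp hθ'.2
    rw [hcomm] at this
    exact surjective_of_lTensor_surjective_of_isLocalHom S _ (this.of_comp_left hθ.1)
  · intro hs
    have := hθ.2.comp (LinearMap.lTensor_surjective S hs)
    rw [← hcomm] at this
    exact this.of_comp

end HomBaseChange

/-! ### Higher Ext under base change -/

section BaseChangeExt

variable {R : Type u} [CommRing R] [IsNoetherianRing R] {S : Type u} [CommRing S] [Algebra R S]
  {P : FiniteFlatResolution R S} {M N : Type u} [AddCommGroup M] [Module R M] [Module.Finite R M]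
  [AddCommGroup N] [Module R N] [Module.Finite R N]
  [IsLocalRing R] [IsLocalRing S] [IsLocalHom (algebraMap R S)]

/-- For Tor-independent modules, the highest nonvanishing `Ext` is detected by base change along
a local homomorphism of finite flat dimension. -/
theorem extVanishes_baseChange_iff {n : ℕ} (hM : TorVanishesAbove P 0 M)
    (hN : TorVanishesAbove P 0 N) (h : ∀ i, n + 1 < i → ExtVanishes R M N i) :
    ExtVanishes S (S ⊗[R] M) (S ⊗[R] N) (n + 1) ↔ ExtVanishes R M N (n + 1) := by
  induction n generalizing M with
  | zero => exact extVanishes_one_baseChange_iff hM hN fun i ↦ h _ (by lia)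
  | succ n ih =>
    obtain ⟨b, p, hp⟩ := Module.Finite.exists_fin' R M
    have hi := (LinearMap.ker p).injective_subtype
    have hip := LinearMap.exact_subtype_ker_map p
    have hiS : Function.Injective ((LinearMap.ker p).subtype.baseChange S) :=
      hM.lTensor_injective hi hip hp
    have hK : TorVanishesAbove P 0 (LinearMap.ker p) :=
      (torVanishesAbove_of_flat 0).of_shortExact hi hip hp (hM.mono zero_le_one)
    rw [extVanishes_add_two_iff hiS (p := p.baseChange S) (lTensor_exact S hip hp)
      (LinearMap.lTensor_surjective S hp), extVanishes_add_two_iff_ker hp]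
    refine ih hK fun i hni ↦ ?_
    obtain ⟨j, rfl⟩ : ∃ j, i = j + 1 := ⟨i - 1, by lia⟩
    exact (extVanishes_add_two_iff_ker hp j).mp (h _ (by lia))

theorem extVanishes_baseChange {n : ℕ} (hM : TorVanishesAbove P 0 M)
    (hN : TorVanishesAbove P 0 N) (h : ∀ i, n < i → ExtVanishes R M N i) :
    ∀ i, n < i → ExtVanishes S (S ⊗[R] M) (S ⊗[R] N) i := by
  intro i hi
  obtain ⟨j, rfl⟩ : ∃ j, i = j + 1 := ⟨i - 1, by lia⟩
  exact (extVanishes_baseChange_iff hM hN fun k hk ↦ h k (by lia)).mpr (h _ hi)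

theorem extVanishes_baseChange_self (hM : TorVanishesAbove P 0 M)
    (h : ∀ i, 0 < i → ExtVanishes R M R i) :
    ∀ i, 0 < i → ExtVanishes S (S ⊗[R] M) S i := by
  intro i hi
  have := extVanishes_baseChange hM (torVanishesAbove_of_flat 0) h i hi
  obtain ⟨j, rfl⟩ : ∃ j, i = j + 1 := ⟨i - 1, by lia⟩
  let e := TensorProduct.AlgebraTensorModule.rid R S S
  exact this.of_retract e.symm.toLinearMap e.toLinearMap (by ext; simp [e])

end BaseChangeExt

/-! ### Syzygies of modules with `Ext^i(M, R) = 0` for `i > 0` -/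

section Syzygy

variable {R : Type u} [CommRing R] {M : Type u} [AddCommGroup M] [Module R M]
  {b : ℕ} {p : (Fin b → R) →ₗ[R] M}

theorem extVanishes_ker_of_extVanishes (hp : Function.Surjective p)
    (h : ∀ i, 0 < i → ExtVanishes R M R i) :
    ∀ i, 0 < i → ExtVanishes R (LinearMap.ker p) R i := by
  intro i hi
  obtain ⟨j, rfl⟩ : ∃ j, i = j + 1 := ⟨i - 1, by lia⟩
  exact (extVanishes_add_two_iff_ker hp j).mp (h _ (by lia))

/-- If `Ext^i(M, R) = 0` for all `i > 0`, then `Ext^i(ΩM, ΩN) = Ext^i(M, N)` for all `i > 0`. -/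
theorem extVanishes_ker_ker_iff (hp : Function.Surjective p)
    (h : ∀ i, 0 < i → ExtVanishes R M R i) {N : Type u} [AddCommGroup N] [Module R N]
    {c : ℕ} {q : (Fin c → R) →ₗ[R] N} (hq : Function.Surjective q) {i : ℕ} (hi : 0 < i) :
    ExtVanishes R (LinearMap.ker p) (LinearMap.ker q) i ↔ ExtVanishes R M N i := by
  obtain ⟨j, rfl⟩ : ∃ j, i = j + 1 := ⟨i - 1, by lia⟩
  rw [← extVanishes_add_two_iff_ker hp]
  exact extVanishes_succ_iff_of_extVanishes_middle (LinearMap.ker q).injective_subtype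
    (LinearMap.exact_subtype_ker_map q) hq (j + 1)
    (ExtVanishes.pi fun _ ↦ h _ (by lia)) (ExtVanishes.pi fun _ ↦ h _ (by lia))

/-- `Ext^1(M, ΩM)` vanishes along with `Ext^1(ΩM, ΩΩM)`, so the cover of `M` splits. -/
theorem projective_of_projective_ker [IsNoetherianRing R] (hp : Function.Surjective p)
    (h : ∀ i, 0 < i → ExtVanishes R M R i) [Module.Projective R (LinearMap.ker p)] :
    Module.Projective R M := by
  obtain ⟨c, q, hq⟩ := Module.Finite.exists_fin' R (LinearMap.ker p)
  exact projective_of_extVanishes_ker hp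
    ((extVanishes_ker_ker_iff hp h hq one_pos).mp (extVanishes_of_projective 0))

end Syzygy

/-! ### Descent of the two conditions from `S` to `R` -/

section Descent

variable {R S : Type u} [CommRing R] [IsNoetherianRing R] [IsLocalRing R]
  [CommRing S] [IsLocalRing S] [Algebra R S] [IsLocalHom (algebraMap R S)]

theorem SymmetricAuslanderCondition.of_finiteFlatResolution (P : FiniteFlatResolution R S)
    (hS : SymmetricAuslanderCondition S) : SymmetricAuslanderCondition R := by
  intro M _ _ _ hMR ⟨n, hn⟩
  suffices ∀ (k : ℕ) (M : Type u) [AddCommGroup M] [Module R M] [Module.Finite R M],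
      TorVanishesAbove P k M → (∀ i, 0 < i → ExtVanishes R M R i) →
      (∀ i, n < i → ExtVanishes R M M i) → ∀ i, 0 < i → ExtVanishes R M M i from
    this P.length M torVanishesAbove_length hMR hn
  clear hMR hn
  intro k
  induction k with
  | zero =>
    intro M _ _ _ hM hMR hn
    have hSM := hS (S ⊗[R] M) (extVanishes_baseChange_self hM hMR)
      ⟨n, extVanishes_baseChange hM hM hn⟩
    -- `hSM` covers all positive degrees, so the bound on nonvanishing `Ext^i(M, M)` can be lowered
    -- one degree at a time.
    induction n with
    | zero => exact hn
    | succ n ih =>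
      refine ih fun i hi ↦ ?_
      obtain rfl | hi : n + 1 = i ∨ n + 1 < i := by lia
      · exact (extVanishes_baseChange_iff hM hM hn).mp (hSM _ n.succ_pos)
      · exact hn i hi
  | succ k ih =>
    intro M _ _ _ hM hMR hn i hi
    obtain ⟨b, p, hp⟩ := Module.Finite.exists_fin' R M
    rw [← extVanishes_ker_ker_iff hp hMR hp hi]
    refine ih _ ((torVanishesAbove_of_flat k).of_shortExact (LinearMap.ker p).injective_subtype
      (LinearMap.exact_subtype_ker_map p) hp hM) (extVanishes_ker_of_extVanishes hp hMR)
      (fun j hj ↦ ?_) i hi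
    exact (extVanishes_ker_ker_iff hp hMR hp (by lia)).mpr (hn j hj)

theorem AuslanderReitenCondition.of_finiteFlatResolution (P : FiniteFlatResolution R S)
    (hS : AuslanderReitenCondition S) : AuslanderReitenCondition R := by
  intro M _ _ _ h
  have hsucc {i : ℕ} (hi : 0 < i) : ∃ j, i = j + 1 := ⟨i - 1, by lia⟩
  suffices ∀ (k : ℕ) (M : Type u) [AddCommGroup M] [Module R M] [Module.Finite R M],
      TorVanishesAbove P k M → (∀ i, 0 < i → ExtVanishes R M R i) →
      (∀ i, 0 < i → ExtVanishes R M M i) → Module.Projective R M by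
    refine this P.length M torVanishesAbove_length (fun i hi ↦ ?_) fun i hi ↦ ?_
    · obtain ⟨j, rfl⟩ := hsucc hi
      exact (h _ hi).of_retract (.inr R M R) (.snd R M R) (by ext; simp)
    · obtain ⟨j, rfl⟩ := hsucc hi
      exact (h _ hi).of_retract (.inl R M R) (.fst R M R) (by ext; simp)
  clear h
  intro k
  induction k with
  | zero =>
    intro M _ _ _ hM hMR hMM
    have hSM : Module.Projective S (S ⊗[R] M) := by
      refine hS _ fun i hi ↦ ?_
      have h₁ := extVanishes_baseChange hM hM hMM i hi
      have h₂ := extVanishes_baseChange_self hM hMR i hi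
      obtain ⟨j, rfl⟩ := hsucc hi
      exact h₁.prod h₂
    obtain ⟨b, p, hp⟩ := Module.Finite.exists_fin' R M
    have hi := (LinearMap.ker p).injective_subtype
    have hip := LinearMap.exact_subtype_ker_map p
    have hK : TorVanishesAbove P 0 (LinearMap.ker p) :=
      (torVanishesAbove_of_flat 0).of_shortExact hi hip hp (hM.mono zero_le_one)
    -- Descent is applied to the pair `(M, ΩM)`; the higher vanishing it needs is `Ext^{i+2}(M, ΩM)
    -- = Ext^{i+1}(M, M) = 0`.
    refine projective_of_extVanishes_ker hp
      ((extVanishes_one_baseChange_iff hM hK fun i ↦ ?_).mp (extVanishes_of_projective 0))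
    exact (extVanishes_succ_iff_of_extVanishes_middle hi hip hp (i + 1)
      (ExtVanishes.pi fun _ ↦ hMR _ (by lia)) (ExtVanishes.pi fun _ ↦ hMR _ (by lia))).mpr
      (hMM _ i.succ_pos)
  | succ k ih =>
    intro M _ _ _ hM hMR hMM
    obtain ⟨b, p, hp⟩ := Module.Finite.exists_fin' R M
    have := ih (LinearMap.ker p) ((torVanishesAbove_of_flat k).of_shortExact
      (LinearMap.ker p).injective_subtype (LinearMap.exact_subtype_ker_map p) hp hM)
      (extVanishes_ker_of_extVanishes hp hMR)
      fun i hi ↦ (extVanishes_ker_ker_iff hp hMR hp hi).mpr (hMM i hi)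
    exact projective_of_projective_ker hp hMR

end Descent

theorem theorem3p1 (R S : Type u) [CommRing R] [IsNoetherianRing R] [IsLocalRing R]
    [CommRing S] [IsNoetherianRing S] [IsLocalRing S] [Algebra R S]
    [IsLocalHom (algebraMap R S)] (hfd : HasFiniteFlatDimension R S) :
    (SymmetricAuslanderCondition S → SymmetricAuslanderCondition R) ∧
      (AuslanderReitenCondition S → AuslanderReitenCondition R) := by
  obtain ⟨P⟩ := hfd.nonempty_finiteFlatResolution
  exact ⟨.of_finiteFlatResolution P, .of_finiteFlatResolution P⟩
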